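/- Consider the deterministic asymmetric 3-user relay network (Y-channel): users $1,2,3$ have no direct links and communicate only through a relay $R$, and each user $i$ has a private message for each other user $j$, at rate $R_{ij}\ge 0$ (in bits per channel use). The channel is the linear deterministic one with nonnegative integer uplink gains $n_{1R},n_{2R},n_{3R}$ and downlink gains $n_{R1},n_{R2},n_{R3}$, where $n_{iR}$ and $n_{Ri}$ may differ: with $q$ the largest of the six gains and $S$ the $q\times q$ down-shift matrix over $\mathbb F_2$, inputs are vectors in $\mathbb F_2^q$; in the uplink phase of a channel use the relay receives $y_R=\sum_i S^{q-n_{iR}}x_i$, and in its downlink phase user $i$ receives $y_i=S^{q-n_{Ri}}x_R$. User $i$ forms its inputs causally from its two messages and its previously received signals, and the relay forms its inputs causally from its received signals. A tuple of nonnegative rates is achievable if there are codes of block length $N$ with $\lceil 2^{NR_{ij}}\rceil$ messages from $i$ to $j$, independent and uniformly distributed, whose probability of any decoding error tends to $0$ as $N\to\infty$; the capacity region is the closure of the set of achievable rate tuples. **Theorem.** Let $\{u,v,t\}=\{w,y,z\}=\{1,2,3\}$ with $n_{uR}\ge n_{vR}\ge n_{tR}$ and $n_{Rw}\ge n_{Ry}\ge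 n_{Rz}$. The capacity region of this network is the set of all nonnegative rate tuples $(R_{ij})_{i\ne j}$ that satisfy \begin{align*} R_{tu}+R_{tv}&\le n_{tR},\\ R_{wz}+R_{yz}&\le n_{Rz},\\ R_{tu}+R_{vu}+\max(R_{tv},R_{vt})&\le n_{vR},\\ R_{wz}+R_{wy}+\max(R_{yz},R_{zy})&\le n_{Ry},\\ R_{uv}+R_{ut}+\max(R_{tv},R_{vt})&\le n_{uR},\\ R_{vu}+R_{vt}+\max(R_{tu},R_{ut})&\le n_{uR},\\ R_{tu}+R_{tv}+\max(R_{uv},R_{vu})&\le n_{uR},\\ R_{wz}+R_{yz}+\max(R_{wy},R_{yw})&\le n_{Rw},\\ R_{yw}+R_{zw}+\max(R_{zy},R_{yz})&\le n_{Rw},\\ R_{wy}+R_{zy}+\max(R_{wz},R_{zw})&\le n_{Rw}. \end{align*} -/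

import Mathlib

namespace YChannel

/-- Ordered pairs of distinct users; `⟨(i, j), _⟩` labels the message from user `i` to user `j`. -/
abbrev UserPair : Type := {p : Fin 3 × Fin 3 // p.1 ≠ p.2}

/-- A rate tuple: one real number for each of the six private messages. -/
abbrev RateTuple : Type := UserPair → ℝ

/-- `R.rate i j` is the rate `R_{ij}` from user `i` to user `j`
(the value `0` for `i = j` is a dummy: there is no such message). -/
def RateTuple.rate (R : RateTuple) (i j : Fin 3) : ℝ :=
  if h : i ≠ j then R ⟨(i, j), h⟩ else 0

/-- A signal of the linear deterministic model: a vector of `q` bits,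
where level `0` is the most significant one. -/
abbrev Signal (q : ℕ) : Type := Fin q → ZMod 2

/-- The action of `S ^ k`, with `S` the `q × q` down-shift matrix: the signal moves down
by `k` levels, the `k` least significant bits are lost and zeros enter at the top. -/
def shift {q : ℕ} (k : ℕ) (x : Signal q) : Signal q := fun l =>
  if k ≤ (l : ℕ) then x ⟨(l : ℕ) - k, lt_of_le_of_lt (Nat.sub_le _ _) l.isLt⟩ else 0

/-- The length `q` of the signals: the largest of all the channel gains. -/
def numLevels (nUp nDown : Fin 3 → ℕ) : ℕ :=
  max (Finset.univ.sup nUp) (Finset.univ.sup nDown)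

/-- Output of the uplink at the relay: `∑ i, S ^ (q - n_{iR}) x_i` over the field of two elements. -/
def uplink {q : ℕ} (nUp : Fin 3 → ℕ) (x : Fin 3 → Signal q) : Signal q :=
  ∑ i, shift (q - nUp i) (x i)

/-- Output of the downlink at user `i`: `S ^ (q - n_{Ri}) x_R`. -/
def downlink {q : ℕ} (nDown : Fin 3 → ℕ) (i : Fin 3) (xR : Signal q) : Signal q :=
  shift (q - nDown i) xR

/-- All six messages; message `p` takes `M p` values. -/
abbrev Messages (M : UserPair → ℕ) : Type := ∀ p : UserPair, Fin (M p)

/-- The two messages that originate at user `i`. -/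
abbrev OwnMessages (M : UserPair → ℕ) (i : Fin 3) : Type :=
  ∀ p : {p : UserPair // p.1.1 = i}, Fin (M p.1)

/-- The part of the message tuple that is known to user `i` at the outset. -/
def own {M : UserPair → ℕ} (W : Messages M) (i : Fin 3) : OwnMessages M i := fun p => W p.1

/-- A causal code. The lists are the sequences of signals received so far, the most recent one
first; their length tells the current time, so all the maps may vary with time.
* A user forms its input from its own messages and the signals that it received before.
* The relay forms its input from the signals that it received.
* The estimate of message `p` is formed at its destination `p.1.2`, from that user's own messages
  and all the signals that it received. -/
structure Code (q : ℕ) (M : UserPair → ℕ) where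
  encode : ∀ i : Fin 3, OwnMessages M i → List (Signal q) → Signal q
  relay : List (Signal q) → Signal q
  decode : ∀ p : UserPair, OwnMessages M p.1.2 → List (Signal q) → Fin (M p)

/-- The signals received after a number of channel uses by the relay (first component) and by
the users (second component), when the messages are `W`. One channel use consists of an uplink
phase, in which the users transmit and the relay listens, and a downlink phase, in which the relay
transmits and the users listen. -/
def Code.received {q : ℕ} {M : UserPair → ℕ} (c : Code q M) (nUp nDown : Fin 3 → ℕ)
    (W : Messages M) : ℕ → List (Signal q) × (Fin 3 → List (Signal q))
  | 0 => ([], fun _ => [])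
  | s + 1 =>
    let past := c.received nUp nDown W s
    let yR := uplink nUp (fun i => c.encode i (own W i) (past.2 i)) :: past.1
    (yR, fun i => downlink nDown i (c.relay yR) :: past.2 i)

/-- After `N` channel uses, every message is decoded correctly at its destination. -/
def Code.Correct {q : ℕ} {M : UserPair → ℕ} (c : Code q M) (nUp nDown : Fin 3 → ℕ)
    (N : ℕ) (W : Messages M) : Prop :=
  ∀ p : UserPair, c.decode p (own W p.1.2) ((c.received nUp nDown W N).2 p.1.2) = W p

open Classical in
/-- The probability that some message is decoded wrongly after `N` channel uses, when the six
messages are independent and uniformly distributed. -/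
noncomputable def Code.errorProb {q : ℕ} {M : UserPair → ℕ} (c : Code q M)
    (nUp nDown : Fin 3 → ℕ) (N : ℕ) : ℝ :=
  ((Finset.univ.filter fun W : Messages M => ¬ c.Correct nUp nDown N W).card : ℝ) /
    (Fintype.card (Messages M) : ℝ)

/-- The number `⌈2 ^ (N R_{ij})⌉` of values of each message at block length `N`. -/
noncomputable def messageCount (R : RateTuple) (N : ℕ) (p : UserPair) : ℕ :=
  ⌈(2 : ℝ) ^ ((N : ℝ) * R p)⌉₊

/-- A tuple of nonnegative rates is achievable if some sequence of codes, with
`⌈2 ^ (N R_{ij})⌉` messages from user `i` to user `j` at block length `N`, has an error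
probability that tends to `0` as `N → ∞`. -/
def Achievable (nUp nDown : Fin 3 → ℕ) (R : RateTuple) : Prop :=
  (∀ p, 0 ≤ R p) ∧
    ∃ c : ∀ N : ℕ, Code (numLevels nUp nDown) (messageCount R N),
      Filter.Tendsto (fun N => (c N).errorProb nUp nDown N) Filter.atTop (nhds 0)

/-- The capacity region: the closure of the set of achievable rate tuples. -/
def capacityRegion (nUp nDown : Fin 3 → ℕ) : Set RateTuple :=
  closure {R | Achievable nUp nDown R}

end YChannel

/-!
Each inequality bounds the rates of a set `D` of messages that can be recovered, whenever the code
makes no error, from the remaining messages and from `n` observed bits per channel use. Counting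
the correctly decoded message tuples then shows that the error probability stays away from zero
unless the sum of the rates over `D` is at most `n` (`Achievable.sum_le`). For three distinct users
`a`, `b`, `c` the set `D` consists of the messages `b → a`, `c → a` and `c → b`. User `a` decodes
first; what it learns, together with the message `b → c`, is all that `b` knows, so `b` can decode
next. The observed bits are either the relay's signal after subtraction of the known signal of `a`,
at most `max n_{bR} n_{cR}` bits, or the part of the relay's input that `a` or `b` sees, at most
`max n_{Ra} n_{Rb}` bits. With the two cuts around the weakest transmitter and the weakest receiver
these bounds give all the inequalities.

For the other inclusion, a tuple of the region is scaled down slightly and rounded to numbers of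
bits per block of `L` channel uses. The bits are combined into sums over `𝔽₂`, each of which the
relay receives in one slot of the uplink and forwards in one slot of the downlink. The sum of two
bits in opposite directions between two users serves both. If the excess of one direction
over the other forms a cycle `a → k → b → a`, then three bits around the cycle are served by the two
sums `x_{ak} + x_{kb}` and `x_{kb} + x_{ba}`; when the cycle is used up, the excess is acyclic, and
the number of sums is the sum of the rates over a transitive orientation of the triangle
(`IsCycleExcess.sum_size_le`). This arrangement is wasteful for `k` as a transmitter
and for `a` as a receiver, but by rotating the cycle one can avoid that `k` is the weakest
transmitter or `a` the weakest receiver (`exists_cycle`). Since the slots that the users reach, and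
those that they hear, are nested, Hall's theorem assigns the slots (`exists_slots`). Finally the
blocks are pipelined: the relay forwards in each block what it received in the previous one, at the
cost of a single block (`RelayScheme.exists_code`, `achievable_smul`).
-/

namespace YChannel

/-! ### Converse -/

/-- The signal that user `i` transmits in channel use `s`. -/
def Code.userInput {q : ℕ} {M : UserPair → ℕ} (c : Code q M) (nUp nDown : Fin 3 → ℕ)
    (W : Messages M) (s : ℕ) (i : Fin 3) : Signal q :=
  c.encode i (own W i) ((c.received nUp nDown W s).2 i)

/-- The signal that the relay transmits in channel use `s`. -/
def Code.relayInput {q : ℕ} {M : UserPair → ℕ} (c : Code q M) (nUp nDown : Fin 3 → ℕ)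
    (W : Messages M) (s : ℕ) : Signal q :=
  c.relay (c.received nUp nDown W (s + 1)).1

lemma shift_apply_eq_zero {q k : ℕ} (x : Signal q) {l : Fin q} (h : (l : ℕ) < k) :
    shift k x l = 0 := by
  simp [shift, not_le.2 h]

/-- Knowing the messages of the users in `A`, one can subtract their signals causally; what
remains of the relay's observations are the lowest `n` levels of the signals of the other users. -/
lemma Code.received_eq_of_uplink {q : ℕ} {M : UserPair → ℕ} (c : Code q M)
    {nUp : Fin 3 → ℕ} (nDown : Fin 3 → ℕ) (A : Finset (Fin 3)) {n : ℕ}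
    (hn : ∀ i ∉ A, nUp i ≤ n) {W W' : Messages M} (hA : ∀ i ∈ A, own W i = own W' i) (N : ℕ)
    (hobs : ∀ s < N, ∀ l : Fin q, q - n ≤ (l : ℕ) →
      (∑ i ∈ Aᶜ, shift (q - nUp i) (c.userInput nUp nDown W s i)) l =
        (∑ i ∈ Aᶜ, shift (q - nUp i) (c.userInput nUp nDown W' s i)) l) :
    c.received nUp nDown W N = c.received nUp nDown W' N := by
  induction N with
  | zero => rfl
  | succ N ih =>
    have ih' := ih fun s hs => hobs s (hs.trans (Nat.lt_succ_self N))
    have hup : uplink nUp (fun i => c.encode i (own W i) ((c.received nUp nDown W N).2 i)) =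
        uplink nUp (fun i => c.encode i (own W' i) ((c.received nUp nDown W' N).2 i)) := by
      unfold uplink
      rw [← Finset.sum_add_sum_compl A, ← Finset.sum_add_sum_compl A]
      congr 1
      · exact Finset.sum_congr rfl fun i hi => by simp only [hA i hi, ih']
      · ext l
        by_cases hl : q - n ≤ (l : ℕ)
        · exact hobs N (Nat.lt_succ_self N) l hl
        · rw [Finset.sum_apply, Finset.sum_apply]
          refine Finset.sum_congr rfl fun i hi => ?_
          have := hn i (Finset.mem_compl.1 hi)
          rw [shift_apply_eq_zero _ (by omega), shift_apply_eq_zero _ (by omega)]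
    simp only [Code.received]
    rw [hup, ih']

/-- A user `i` with downlink gain at most `n` sees nothing but the `n` highest levels of the
signals of the relay. -/
lemma Code.received_user_eq_of_downlink {q : ℕ} {M : UserPair → ℕ} (c : Code q M)
    (nUp : Fin 3 → ℕ) {nDown : Fin 3 → ℕ} {i : Fin 3} {n : ℕ} (hn : nDown i ≤ n)
    {W W' : Messages M} (N : ℕ)
    (hobs : ∀ s < N, ∀ l : Fin q, (l : ℕ) < n →
      c.relayInput nUp nDown W s l = c.relayInput nUp nDown W' s l) :
    (c.received nUp nDown W N).2 i = (c.received nUp nDown W' N).2 i := by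
  induction N with
  | zero => rfl
  | succ N ih =>
    have ih' := ih fun s hs => hobs s (hs.trans (Nat.lt_succ_self N))
    have hd : downlink nDown i (c.relayInput nUp nDown W N) =
        downlink nDown i (c.relayInput nUp nDown W' N) := by
      ext l
      unfold downlink shift
      split_ifs with h
      · exact hobs N (Nat.lt_succ_self N) _ (by have := l.isLt; simp only; omega)
      · rfl
    change downlink nDown i (c.relayInput nUp nDown W N) :: (c.received nUp nDown W N).2 i =
      downlink nDown i (c.relayInput nUp nDown W' N) :: (c.received nUp nDown W' N).2 i
    rw [hd, ih']

/-- If the messages in `D` can be recovered from the other messages and from `N * n` observed bits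
whenever the code is correct, then the messages are correct for a small number of tuples. -/
lemma card_correct_mul_prod_le {M : UserPair → ℕ} (G : Finset (Messages M))
    (D : Finset UserPair) {N n : ℕ} (obs : Messages M → Fin N → Fin n → ZMod 2)
    (h : ∀ W ∈ G, ∀ W' ∈ G, (∀ p ∉ D, W p = W' p) → obs W = obs W' → W = W') :
    G.card * ∏ p ∈ D, M p ≤ 2 ^ (n * N) * Fintype.card (Messages M) := by
  have hcard : G.card ≤ (∏ p ∈ Dᶜ, M p) * 2 ^ (n * N) := by
    have h1 := Finset.card_le_card_of_injOn
      (s := G) (t := (Finset.univ : Finset ((∀ p : {p // p ∈ Dᶜ}, Fin (M p.1)) ×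
        (Fin N → Fin n → ZMod 2))))
      (fun W => (fun p => W p.1, obs W)) (fun _ _ => Finset.mem_coe.2 (Finset.mem_univ _))
      (fun W hW W' hW' e => by
        simp only [Prod.mk.injEq] at e
        refine h W hW W' hW' (fun p hp => ?_) e.2
        exact congrFun e.1 ⟨p, Finset.mem_compl.2 hp⟩)
    have h2 : ∏ p : {p // p ∈ Dᶜ}, M p.1 = ∏ p ∈ Dᶜ, M p := Finset.prod_coe_sort Dᶜ M
    simpa only [Finset.card_univ, Fintype.card_prod, Fintype.card_pi, Fintype.card_fin, ZMod.card,
      Finset.prod_const, pow_mul, h2] using h1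
  have htot : Fintype.card (Messages M) = (∏ p ∈ Dᶜ, M p) * ∏ p ∈ D, M p := by
    rw [Fintype.card_pi, Finset.prod_compl_mul_prod]
    simp
  rw [htot]
  calc _ ≤ (∏ p ∈ Dᶜ, M p) * 2 ^ (n * N) * ∏ p ∈ D, M p := Nat.mul_le_mul_right _ hcard
    _ = _ := by ring

/-- Strong converse: if, for every code, the messages in `D` can be recovered from the other
messages and from `n` observed bits per channel use whenever they are all decoded correctly, then
the sum of their rates is at most `n`; otherwise the error probability is bounded below. -/
lemma Achievable.sum_le {nUp nDown : Fin 3 → ℕ} {R : RateTuple} (hR : Achievable nUp nDown R)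
    (D : Finset UserPair) (n : ℕ)
    (h : ∀ (M : UserPair → ℕ) (c : Code (numLevels nUp nDown) M) (N : ℕ),
      ∃ obs : Messages M → Fin N → Fin n → ZMod 2, ∀ W W',
        c.Correct nUp nDown N W → c.Correct nUp nDown N W' →
        (∀ p ∉ D, W p = W' p) → obs W = obs W' → W = W') :
    ∑ p ∈ D, R p ≤ n := by
  classical
  obtain ⟨-, c, hc⟩ := hR
  by_contra! hlt
  set δ : ℝ := ∑ p ∈ D, R p - n with hδ
  have hδ0 : 0 < δ := by linarith
  have hlow : ∀ N : ℕ, 1 ≤ N → 1 - (2 : ℝ) ^ (-δ) ≤ (c N).errorProb nUp nDown N := by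
    intro N hN
    set M := messageCount R N
    obtain ⟨obs, hobs⟩ := h M (c N) N
    set G := Finset.univ.filter fun W : Messages M => (c N).Correct nUp nDown N W with hG
    have hcount := card_correct_mul_prod_le G D obs fun W hW W' hW' =>
      hobs W W' (Finset.mem_filter.1 hW).2 (Finset.mem_filter.1 hW').2
    have hMpos : ∀ p, (2 : ℝ) ^ ((N : ℝ) * R p) ≤ M p := fun p => Nat.le_ceil _
    have hTpos : (0 : ℝ) < Fintype.card (Messages M) := by
      rw [Fintype.card_pi]
      push_cast
      refine Finset.prod_pos fun p _ => ?_
      simpa using (Real.rpow_pos_of_pos two_pos _).trans_le (hMpos p)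
    have hsplit : ((Finset.univ.filter fun W : Messages M =>
        ¬ (c N).Correct nUp nDown N W).card : ℝ) = Fintype.card (Messages M) - G.card := by
      have := Finset.card_filter_add_card_filter_not (s := (Finset.univ : Finset (Messages M)))
        (fun W => (c N).Correct nUp nDown N W)
      rw [Finset.card_univ] at this
      rw [← this, hG]
      push_cast
      ring
    have herr : (c N).errorProb nUp nDown N =
        ((Fintype.card (Messages M) : ℝ) - G.card) / Fintype.card (Messages M) := by
      rw [← hsplit]
      unfold Code.errorProb
      congr!
    have hprod : (2 : ℝ) ^ ((N : ℝ) * ∑ p ∈ D, R p) ≤ ∏ p ∈ D, (M p : ℝ) := by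
      rw [Finset.mul_sum, Real.rpow_sum_of_pos two_pos]
      exact Finset.prod_le_prod (fun p _ => (Real.rpow_pos_of_pos two_pos _).le)
        fun p _ => hMpos p
    have hGle : (G.card : ℝ) ≤ (2 : ℝ) ^ (-δ) * Fintype.card (Messages M) := by
      have h1 : (G.card : ℝ) * ∏ p ∈ D, (M p : ℝ) ≤
          (2 : ℝ) ^ ((n : ℝ) * N) * Fintype.card (Messages M) := by
        have : (2 : ℝ) ^ ((n : ℝ) * N) = 2 ^ (n * N) := by
          rw [← Nat.cast_mul, Real.rpow_natCast]
        rw [this]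
        exact_mod_cast hcount
      have h2 := (mul_le_mul_of_nonneg_left hprod (Nat.cast_nonneg G.card)).trans h1
      rw [← le_div_iff₀ (Real.rpow_pos_of_pos two_pos _)] at h2
      refine h2.trans ?_
      rw [mul_div_right_comm, ← Real.rpow_sub two_pos]
      refine mul_le_mul_of_nonneg_right ?_ hTpos.le
      refine Real.rpow_le_rpow_of_exponent_le one_le_two ?_
      have : (1 : ℝ) ≤ N := by exact_mod_cast hN
      nlinarith
    rw [herr, le_div_iff₀ hTpos]
    linarith
  have hle : 1 - (2 : ℝ) ^ (-δ) ≤ 0 :=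
    ge_of_tendsto hc ((Filter.eventually_ge_atTop 1).mono hlow)
  have : (2 : ℝ) ^ (-δ) < 1 := Real.rpow_lt_one_of_one_lt_of_neg one_lt_two (by linarith)
  linarith

lemma Code.Correct.apply_eq {q : ℕ} {M : UserPair → ℕ} {c : Code q M} {nUp nDown : Fin 3 → ℕ}
    {N : ℕ} {W W' : Messages M} (h : c.Correct nUp nDown N W) (h' : c.Correct nUp nDown N W')
    {p : UserPair} (hown : own W p.1.2 = own W' p.1.2)
    (hrec : (c.received nUp nDown W N).2 p.1.2 = (c.received nUp nDown W' N).2 p.1.2) :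
    W p = W' p := by
  rw [← h p, ← h' p, hown, hrec]

/-- Uplink bound: the users outside `A` reach only the lowest `n` levels of the relay, so the
messages `D` that they send, if recoverable from everything else, have rate at most `n`. -/
lemma Achievable.sum_le_uplink {nUp nDown : Fin 3 → ℕ} {R : RateTuple}
    (hR : Achievable nUp nDown R) (D : Finset UserPair) (A : Finset (Fin 3)) {n : ℕ}
    (hn : ∀ i ∉ A, nUp i ≤ n) (hDA : ∀ p ∈ D, p.1.1 ∉ A)
    (h : ∀ (M : UserPair → ℕ) (c : Code (numLevels nUp nDown) M) (N : ℕ) (W W' : Messages M),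
      c.Correct nUp nDown N W → c.Correct nUp nDown N W' → (∀ p ∉ D, W p = W' p) →
      (∀ i, (c.received nUp nDown W N).2 i = (c.received nUp nDown W' N).2 i) → W = W') :
    ∑ p ∈ D, R p ≤ n := by
  refine hR.sum_le D n fun M c N => ?_
  refine ⟨fun W s k => if hk : numLevels nUp nDown - n + k < numLevels nUp nDown then
    (∑ i ∈ Aᶜ, shift (numLevels nUp nDown - nUp i) (c.userInput nUp nDown W s i))
      ⟨numLevels nUp nDown - n + k, hk⟩ else 0,
    fun W W' hW hW' hD hobs => h M c N W W' hW hW' hD fun i => ?_⟩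
  rw [c.received_eq_of_uplink nDown A hn (W := W) (W' := W')]
  · intro i hi
    funext p
    exact hD p.1 fun hp => hDA _ hp (by rwa [p.2])
  · intro s hs l hl
    have hl' := l.isLt
    have := congrFun (congrFun hobs ⟨s, hs⟩) ⟨l - (numLevels nUp nDown - n), by omega⟩
    have hidx : numLevels nUp nDown - n + (l - (numLevels nUp nDown - n)) = (l : ℕ) := by omega
    simpa only [hidx, l.isLt, dite_true] using this

/-- Downlink bound: the users in `B` see only the highest `n` levels of the signals of the relay,
so the messages that they alone can recover from everything else have rate at most `n`. -/
lemma Achievable.sum_le_downlink {nUp nDown : Fin 3 → ℕ} {R : RateTuple}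
    (hR : Achievable nUp nDown R) (D : Finset UserPair) (B : Finset (Fin 3)) {n : ℕ}
    (hn : ∀ i ∈ B, nDown i ≤ n)
    (h : ∀ (M : UserPair → ℕ) (c : Code (numLevels nUp nDown) M) (N : ℕ) (W W' : Messages M),
      c.Correct nUp nDown N W → c.Correct nUp nDown N W' → (∀ p ∉ D, W p = W' p) →
      (∀ i ∈ B, (c.received nUp nDown W N).2 i = (c.received nUp nDown W' N).2 i) → W = W') :
    ∑ p ∈ D, R p ≤ n := by
  refine hR.sum_le D n fun M c N => ?_
  refine ⟨fun W s k => if hk : (k : ℕ) < numLevels nUp nDown then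
    c.relayInput nUp nDown W s ⟨k, hk⟩ else 0,
    fun W W' hW hW' hD hobs => h M c N W W' hW hW' hD fun i hi => ?_⟩
  refine c.received_user_eq_of_downlink nUp (hn i hi) N fun s hs l hl => ?_
  have := congrFun (congrFun hobs ⟨s, hs⟩) ⟨l, hl⟩
  simpa only [l.isLt, dite_true] using this

/-! ### Chains and cuts -/

lemma RateTuple.rate_of_ne (R : RateTuple) {i j : Fin 3} (h : i ≠ j) :
    R.rate i j = R ⟨(i, j), h⟩ := dif_pos h

lemma eq_of_three {a b c : Fin 3} (hab : a ≠ b) (hac : a ≠ c) (hbc : b ≠ c) (i : Fin 3) :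
    i = a ∨ i = b ∨ i = c := by
  omega

/-- The messages from `b` and `c` to `a`, together with the message from `c` to `b`. -/
def chainPairs {a b c : Fin 3} (hab : a ≠ b) (hac : a ≠ c) (hbc : b ≠ c) : Finset UserPair :=
  {⟨(b, a), hab.symm⟩, ⟨(c, a), hac.symm⟩, ⟨(c, b), hbc.symm⟩}

lemma sum_chainPairs {a b c : Fin 3} (hab : a ≠ b) (hac : a ≠ c) (hbc : b ≠ c) (R : RateTuple) :
    ∑ p ∈ chainPairs hab hac hbc, R p = R.rate b a + R.rate c a + R.rate c b := by
  rw [chainPairs, Finset.sum_insert, Finset.sum_insert, Finset.sum_singleton,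
    R.rate_of_ne hab.symm, R.rate_of_ne hac.symm, R.rate_of_ne hbc.symm, add_assoc]
  · simp [hab]
  · simp [hbc]

/-- Successive decoding along the chain: user `a` recovers the messages that are meant for it;
together with the message from `b` to `c` they are all that user `b` knows at the outset, so the
message from `c` to `b` is recovered next. -/
lemma eq_of_chainPairs {a b c : Fin 3} (hab : a ≠ b) (hac : a ≠ c) (hbc : b ≠ c) {q : ℕ}
    {M : UserPair → ℕ} {C : Code q M} {nUp nDown : Fin 3 → ℕ} {N : ℕ} {W W' : Messages M}
    (hW : C.Correct nUp nDown N W) (hW' : C.Correct nUp nDown N W')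
    (hD : ∀ p ∉ chainPairs hab hac hbc, W p = W' p)
    (ha : (C.received nUp nDown W N).2 a = (C.received nUp nDown W' N).2 a)
    (hb : (C.received nUp nDown W N).2 b = (C.received nUp nDown W' N).2 b) : W = W' := by
  have hmem : ∀ i j (h : i ≠ j), ⟨(i, j), h⟩ ∈ chainPairs hab hac hbc ↔
      (i = b ∧ j = a) ∨ (i = c ∧ j = a) ∨ (i = c ∧ j = b) := by
    intro i j h
    simp [chainPairs]
  have hA : own W a = own W' a := by
    funext ⟨⟨⟨i, j⟩, h⟩, hi⟩
    obtain rfl : i = a := hi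
    exact hD _ fun hp => by rw [hmem] at hp; omega
  have htoa : ∀ i (h : i ≠ a), W ⟨(i, a), h⟩ = W' ⟨(i, a), h⟩ :=
    fun i h => hW.apply_eq hW' (p := ⟨(i, a), h⟩) hA ha
  have hB : own W b = own W' b := by
    funext ⟨⟨⟨i, j⟩, h⟩, hi⟩
    obtain rfl : i = b := hi
    by_cases hj : j = a
    · subst hj
      exact htoa _ h
    · exact hD _ fun hp => by rw [hmem] at hp; omega
  have htob : ∀ i (h : i ≠ b), W ⟨(i, b), h⟩ = W' ⟨(i, b), h⟩ :=
    fun i h => hW.apply_eq hW' (p := ⟨(i, b), h⟩) hB hb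
  funext ⟨⟨i, j⟩, h⟩
  by_cases hja : j = a
  · subst hja
    exact htoa _ h
  by_cases hjb : j = b
  · subst hjb
    exact htob _ h
  exact hD _ fun hp => by rw [hmem] at hp; omega

lemma Achievable.chain_uplink {nUp nDown : Fin 3 → ℕ} {R : RateTuple}
    (hR : Achievable nUp nDown R) {a b c : Fin 3} (hab : a ≠ b) (hac : a ≠ c) (hbc : b ≠ c) {n : ℕ}
    (hb : nUp b ≤ n) (hc : nUp c ≤ n) : R.rate b a + R.rate c a + R.rate c b ≤ n := by
  rw [← sum_chainPairs hab hac hbc]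
  refine hR.sum_le_uplink _ {a} (fun i hi => ?_) ?_
    fun M C N W W' hW hW' hD hrec => eq_of_chainPairs hab hac hbc hW hW' hD (hrec a) (hrec b)
  · rcases eq_of_three hab hac hbc i with rfl | rfl | rfl
    · simp at hi
    · exact hb
    · exact hc
  · simp [chainPairs, hab.symm, hac.symm]

lemma Achievable.chain_downlink {nUp nDown : Fin 3 → ℕ} {R : RateTuple}
    (hR : Achievable nUp nDown R) {a b c : Fin 3} (hab : a ≠ b) (hac : a ≠ c) (hbc : b ≠ c) {n : ℕ}
    (ha : nDown a ≤ n) (hb : nDown b ≤ n) : R.rate b a + R.rate c a + R.rate c b ≤ n := by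
  rw [← sum_chainPairs hab hac hbc]
  refine hR.sum_le_downlink _ {a, b} (by simp [ha, hb])
    fun M C N W W' hW hW' hD hrec =>
      eq_of_chainPairs hab hac hbc hW hW' hD (hrec a (by simp)) (hrec b (by simp))

lemma Achievable.cut_uplink {nUp nDown : Fin 3 → ℕ} {R : RateTuple}
    (hR : Achievable nUp nDown R) {a b c : Fin 3} (hab : a ≠ b) (hac : a ≠ c) (hbc : b ≠ c) :
    R.rate a b + R.rate a c ≤ nUp a := by
  have hsum : ∑ p ∈ ({⟨(a, b), hab⟩, ⟨(a, c), hac⟩} : Finset UserPair), R p =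
      R.rate a b + R.rate a c := by
    rw [Finset.sum_insert, Finset.sum_singleton, R.rate_of_ne hab, R.rate_of_ne hac]
    simp [hbc]
  rw [← hsum]
  refine hR.sum_le_uplink _ {b, c} (fun i hi => ?_) (by simp [hab, hac])
    fun M C N W W' hW hW' hD hrec => ?_
  · rcases eq_of_three hab hac hbc i with rfl | rfl | rfl
    · exact le_rfl
    · simp at hi
    · simp at hi
  · have hown : ∀ i, i ≠ a → own W i = own W' i := by
      rintro i hi
      funext ⟨⟨⟨i', j⟩, h⟩, hi'⟩
      obtain rfl : i' = i := hi'
      exact hD _ (by simp [hi])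
    funext ⟨⟨i, j⟩, h⟩
    by_cases hi : j = a
    · subst hi
      exact hD _ (by simp [h])
    · exact hW.apply_eq hW' (p := ⟨(i, j), h⟩) (hown j hi) (hrec j)

lemma Achievable.cut_downlink {nUp nDown : Fin 3 → ℕ} {R : RateTuple}
    (hR : Achievable nUp nDown R) {a b c : Fin 3} (hab : a ≠ b) (hac : a ≠ c) (hbc : b ≠ c) :
    R.rate b a + R.rate c a ≤ nDown a := by
  have hsum : ∑ p ∈ ({⟨(b, a), hab.symm⟩, ⟨(c, a), hac.symm⟩} : Finset UserPair), R p =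
      R.rate b a + R.rate c a := by
    rw [Finset.sum_insert, Finset.sum_singleton, R.rate_of_ne hab.symm, R.rate_of_ne hac.symm]
    simp [hbc]
  rw [← hsum]
  refine hR.sum_le_downlink _ {a} (by simp) fun M C N W W' hW hW' hD hrec => ?_
  have hown : own W a = own W' a := by
    funext ⟨⟨⟨i, j⟩, h⟩, hi⟩
    obtain rfl : i = a := hi
    exact hD _ (by simp [hab, hac])
  funext ⟨⟨i, j⟩, h⟩
  by_cases hj : j = a
  · subst hj
    exact hW.apply_eq hW' (p := ⟨(i, j), h⟩) hown (hrec j (by simp))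
  · exact hD _ (by simp [hj])

/-! ### Assignment of slots -/

lemma card_filter_sigma_le (N lo φ : Fin 3 → ℕ) :
    (Finset.univ.filter fun j : Σ e : Fin 3, Fin (N e) =>
      lo j.1 ≤ (j.2 : ℕ) ∧ (j.2 : ℕ) < φ j.1).card ≤ ∑ e, (φ e - lo e) := by
  have h := Finset.card_le_card_of_injOn
    (s := Finset.univ.filter fun j : Σ e : Fin 3, Fin (N e) =>
      lo j.1 ≤ (j.2 : ℕ) ∧ (j.2 : ℕ) < φ j.1)
    (t := Finset.univ.sigma fun e : Fin 3 => Finset.Ico (lo e) (φ e))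
    (fun j => ⟨j.1, (j.2 : ℕ)⟩) (fun j hj => by simpa using hj) (by
      rintro ⟨e, m⟩ - ⟨e', m'⟩ - h
      simp only [Sigma.mk.injEq] at h
      obtain ⟨rfl, h⟩ := h
      rw [Fin.ext (eq_of_heq h)])
  simpa using h

/-- Hall's theorem for nested sets of slots. The items are `⟨e, m⟩` with `m < N e`; the item must
get a slot below `cap i` for each user `i` with `lo e i ≤ m < θ e i`. User `t` is the weakest and
user `u` the strongest. -/
lemma exists_slots (N : Fin 3 → ℕ) (lo θ : Fin 3 → Fin 3 → ℕ) (cap : Fin 3 → ℕ) {u v t : Fin 3}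
    (huv : u ≠ v) (hut : u ≠ t) (hvt : v ≠ t) (hcap₁ : cap v ≤ cap u) (hcap₂ : cap t ≤ cap v)
    (ht : ∑ e, (θ e t - lo e t) ≤ cap t) (hv : ∑ e, max (θ e t) (θ e v) ≤ cap v)
    (hu : ∑ e, N e ≤ cap u) :
    ∃ f : (Σ e : Fin 3, Fin (N e)) → ℕ, f.Injective ∧ (∀ j, ∃ i, f j < cap i) ∧
      ∀ j i, lo j.1 i ≤ (j.2 : ℕ) → (j.2 : ℕ) < θ j.1 i → f j < cap i := by
  let T : (Σ e : Fin 3, Fin (N e)) → Finset ℕ := fun j => Finset.range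
    (if lo j.1 t ≤ (j.2 : ℕ) ∧ (j.2 : ℕ) < θ j.1 t then cap t
      else if (j.2 : ℕ) < θ j.1 v then cap v else cap u)
  have hall : ∀ s : Finset (Σ e : Fin 3, Fin (N e)), s.card ≤ (s.biUnion T).card := by
    intro s
    have key : ∀ j ∈ s, ∀ n, T j = Finset.range n → s.card ≤ n → s.card ≤ (s.biUnion T).card :=
      fun j hj n hn hs => (hs.trans (by rw [hn, Finset.card_range])).trans
        (Finset.card_le_card (Finset.subset_biUnion_of_mem T hj))
    by_cases h1 : ∃ j ∈ s, ¬ (lo j.1 t ≤ (j.2 : ℕ) ∧ (j.2 : ℕ) < θ j.1 t) ∧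
        ¬ (j.2 : ℕ) < θ j.1 v
    · obtain ⟨j, hj, hlt⟩ := h1
      refine key j hj (cap u) (by simp only [T, if_neg hlt.1, if_neg hlt.2]) ?_
      refine (Finset.card_le_univ s).trans (le_trans (le_of_eq ?_) hu)
      simp
    by_cases h2 : ∃ j ∈ s, ¬ (lo j.1 t ≤ (j.2 : ℕ) ∧ (j.2 : ℕ) < θ j.1 t)
    · obtain ⟨j, hj, hlt⟩ := h2
      have hlt' : (j.2 : ℕ) < θ j.1 v := by
        by_contra hlt'
        exact h1 ⟨j, hj, hlt, hlt'⟩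
      refine key j hj (cap v) (by simp only [T, if_neg hlt, if_pos hlt']) ?_
      refine ((Finset.card_le_card fun j hj => Finset.mem_filter.2 ⟨Finset.mem_univ j,
        Nat.zero_le _, ?_⟩).trans
        (card_filter_sigma_le N (fun _ => 0) fun e => max (θ e t) (θ e v))).trans hv
      by_contra hj'
      exact h1 ⟨j, hj, by omega, by omega⟩
    push Not at h2
    obtain rfl | ⟨j, hj⟩ := s.eq_empty_or_nonempty
    · simp
    · refine key j hj (cap t) (by simp only [T, if_pos (h2 j hj)]) ?_
      exact ((Finset.card_le_card fun j hj =>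
        Finset.mem_filter.2 ⟨Finset.mem_univ j, h2 j hj⟩).trans
        (card_filter_sigma_le N (fun e => lo e t) fun e => θ e t)).trans ht
  obtain ⟨f, hf, hfT⟩ := (Finset.all_card_le_biUnion_card_iff_exists_injective T).1 hall
  refine ⟨f, hf, fun j => ⟨u, ?_⟩, fun j i hi => ?_⟩
  · have := Finset.mem_range.1 (hfT j)
    split_ifs at this <;> omega
  · have := Finset.mem_range.1 (hfT j)
    rcases eq_of_three huv hut hvt i with rfl | rfl | rfl
    all_goals split_ifs at this <;> omega

/-- A scheme for one block in which the messages are bit strings, `K i j` bits from `i` to `j`.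
The bit strings of one user `i` are `x i : Fin 3 → ℕ → ZMod 2`, padded with zeros. The relay
learns the sums over the users of `contrib · j`, for `j` in the type `J`. In the uplink the sum
`j` occupies the slot `up j`, and the relay forwards it in the slot `down j`; user `i` reaches
the slots below `capUp i` and hears the slots below `capDown i`. -/
structure RelayScheme (K : Fin 3 → Fin 3 → ℕ) (capUp capDown : Fin 3 → ℕ) where
  J : Type
  [fintype : Fintype J]
  contrib : Fin 3 → J → (Fin 3 → ℕ → ZMod 2) → ZMod 2
  up : J → ℕ
  down : J → ℕ
  up_injective : up.Injective
  down_injective : down.Injective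
  up_lt : ∀ j, ∃ i, up j < capUp i
  contrib_eq_zero : ∀ i j (y : Fin 3 → ℕ → ZMod 2), (∀ k m, K i k ≤ m → y k m = 0) →
    capUp i ≤ up j → contrib i j y = 0
  decodes : ∀ i (x x' : Fin 3 → Fin 3 → ℕ → ZMod 2),
    (∀ k l m, K k l ≤ m → x k l m = 0) → (∀ k l m, K k l ≤ m → x' k l m = 0) → x i = x' i →
    (∀ j, down j < capDown i → ∑ k, contrib k j (x k) = ∑ k, contrib k j (x' k)) →
    ∀ k, k ≠ i → x k i = x' k i

attribute [instance] RelayScheme.fintype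

/-! ### Sums for a cycle -/

/-- What user `i` adds to the sum number `m` of the family `e`, for the cycle `a → k → b → a`
with `c` bits per edge. The families belong to the pairs `{a, k}`, `{k, b}` and `{b, a}`. On the
first two the first `c` sums combine two bits of the cycle; all other sums combine one bit in each
direction. The third pair needs no sums for its first `c` bits from `b` to `a`: user `a` gets
them from the first two families. -/
def cycleContrib (a k b : Fin 3) (c : ℕ) (e : Fin 3) (m : ℕ) (i : Fin 3)
    (y : Fin 3 → ℕ → ZMod 2) : ZMod 2 :=
  match e with
  | 0 => if i = a then y k m else if i = k then (if m < c then y b m else y a (m - c)) else 0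
  | 1 => if i = k then y b m else if i = b then (if m < c then y a m else y k (m - c)) else 0
  | 2 => if i = b then y a (m + c) else if i = a then y b m else 0

lemma sum_eq_of_three {a k b : Fin 3} (hak : a ≠ k) (hab : a ≠ b) (hkb : k ≠ b)
    (f : Fin 3 → ZMod 2) : ∑ i, f i = f a + f k + f b := by
  have : (Finset.univ : Finset (Fin 3)) = {a, k, b} := by
    ext i
    simpa using eq_of_three hak hab hkb i
  rw [this, Finset.sum_insert, Finset.sum_insert, Finset.sum_singleton, add_assoc]
  · simpa using hkb
  · simp [hak, hab]

/-- The number of sums in each family of `cycleContrib`. -/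
def cycleSize (K : Fin 3 → Fin 3 → ℕ) (a k b : Fin 3) (c : ℕ) (e : Fin 3) : ℕ :=
  match e with
  | 0 => max (K a k) (c + K k a)
  | 1 => max (K k b) (c + K b k)
  | 2 => max (K b a - c) (K a b)

/-- User `i` takes part in no sums with index from this bound on in family `e`. -/
def cycleSource (K : Fin 3 → Fin 3 → ℕ) (a k b : Fin 3) (c : ℕ) (e i : Fin 3) : ℕ :=
  match e with
  | 0 => if i = a then K a k else if i = k then c + K k a else 0
  | 1 => if i = k then K k b else if i = b then c + K b k else 0
  | 2 => if i = b then K b a - c else if i = a then K a b else 0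

/-- User `i` needs no sums with index below this bound in family `e`. -/
def cycleSinkStart (k : Fin 3) (c : ℕ) (e i : Fin 3) : ℕ :=
  if e = 1 ∧ i = k then c else 0

/-- User `i` needs the sums with index from `cycleSinkStart` up to this bound in family `e`. -/
def cycleSink (K : Fin 3 → Fin 3 → ℕ) (a k b : Fin 3) (c : ℕ) (e i : Fin 3) : ℕ :=
  match e with
  | 0 => if i = a then c + K k a else if i = k then K a k else 0
  | 1 => if i = a then c else if i = k then c + K b k else K k b
  | 2 => if i = a then K b a - c else if i = b then K a b else 0

lemma cycleContrib_eq_zero {K : Fin 3 → Fin 3 → ℕ} {a k b : Fin 3} {c : ℕ} (e : Fin 3) {m : ℕ}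
    {i : Fin 3} {y : Fin 3 → ℕ → ZMod 2} (hy : ∀ k m, K i k ≤ m → y k m = 0)
    (hm : cycleSource K a k b c e i ≤ m) : cycleContrib a k b c e m i y = 0 := by
  fin_cases e <;> simp only [cycleContrib, cycleSource] at hm ⊢ <;> split_ifs at hm ⊢ <;>
    first
    | rfl
    | (subst_vars; refine hy _ _ ?_; omega)

/-- Every user recovers its messages from the sums listed in `cycleSink`. -/
lemma cycle_decodes {K : Fin 3 → Fin 3 → ℕ} {a k b : Fin 3} (hak : a ≠ k) (hab : a ≠ b)
    (hkb : k ≠ b) {c : ℕ} (i : Fin 3) {x x' : Fin 3 → Fin 3 → ℕ → ZMod 2}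
    (hx : ∀ k l m, K k l ≤ m → x k l m = 0) (hx' : ∀ k l m, K k l ≤ m → x' k l m = 0)
    (hi : x i = x' i)
    (h : ∀ e m, cycleSinkStart k c e i ≤ m → m < cycleSink K a k b c e i →
      m < cycleSize K a k b c e →
      ∑ j, cycleContrib a k b c e m j (x j) = ∑ j, cycleContrib a k b c e m j (x' j))
    (l : Fin 3) (hl : l ≠ i) : x l i = x' l i := by
  have h0 := h 0
  have h1 := h 1
  have h2 := h 2
  simp only [sum_eq_of_three hak hab hkb, cycleContrib, cycleSink, cycleSinkStart,
    cycleSize, if_true,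
    hak, hab, hkb, hak.symm, hab.symm, hkb.symm, if_false, add_zero, zero_add,
    show (0 : Fin 3) ≠ 1 by decide, show (2 : Fin 3) ≠ 1 by decide, false_and, true_and,
    Nat.zero_le, forall_const] at h0 h1 h2
  clear h
  funext n
  by_cases hn : K l i ≤ n
  · rw [hx _ _ _ hn, hx' _ _ _ hn]
  rw [not_le] at hn
  rcases eq_of_three hak hab hkb i with rfl | rfl | rfl
  · simp only [if_true, hi, hak, if_false] at h0 h1 h2
    rcases eq_of_three hak hab hkb l with rfl | rfl | rfl
    · exact absurd rfl hl
    · have := h0 (n + c) (by omega) (by omega)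
      simpa using this
    · by_cases hc : n < c
      · have e0 := h0 n (by omega) (by omega)
        have e1 := h1 n (by omega) (by omega) (by omega)
        simp only [hc, if_true, add_right_inj] at e0 e1
        rw [e0] at e1
        simpa using e1
      · have := h2 (n - c) (by omega) (by omega)
        have hnc : n - c + c = n := by omega
        simpa [hnc] using this
  · simp only [if_true, hi, hak.symm, hkb, if_false] at h0 h1 h2
    rcases eq_of_three hak hab hkb l with rfl | rfl | rfl
    · have := h0 n (by omega) (by omega)
      simpa using this
    · exact absurd rfl hl
    · have := h1 (n + c) (by omega) (by omega) (by omega)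
      simpa using this
  · simp only [if_true, hi, hab.symm, hkb.symm, if_false] at h0 h1 h2
    rcases eq_of_three hak hab hkb l with rfl | rfl | rfl
    · have := h2 n (by omega) (by omega)
      simpa using this
    · have := h1 n (by omega) (by omega) (by omega)
      simpa using this
    · exact absurd rfl hl

/-- What makes `c` a suitable number of bits for the cycle `a → k → b → a`: the edges of the
cycle carry `c` bits more than the reversed edges, and what remains is acyclic. -/
structure IsCycleExcess (K : Fin 3 → Fin 3 → ℕ) (a k b : Fin 3) (c : ℕ) : Prop where
  ne_ak : a ≠ k
  ne_ab : a ≠ b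
  ne_kb : k ≠ b
  le : c = 0 ∨ K k a + c ≤ K a k ∧ K b k + c ≤ K k b ∧ K a b + c ≤ K b a
  maximal : K a k ≤ K k a + c ∨ K k b ≤ K b k + c ∨ K b a ≤ K a b + c
  not_reversed : K k a ≤ K a k ∨ K b k ≤ K k b ∨ K a b ≤ K b a

/-- Of the three rotations of a cycle, one avoids both that `k` is the weakest transmitter `t` and
that `a` is the weakest receiver `z`. -/
lemma exists_cycle (K : Fin 3 → Fin 3 → ℕ) (t z : Fin 3) :
    ∃ (a k b : Fin 3) (c : ℕ), k ≠ t ∧ a ≠ z ∧ IsCycleExcess K a k b c := by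
  have key : ∀ p q r : Fin 3, p ≠ q → p ≠ r → q ≠ r →
      (K q p ≤ K p q ∨ K r q ≤ K q r ∨ K p r ≤ K r p) →
      ∃ (a k b : Fin 3) (c : ℕ), k ≠ t ∧ a ≠ z ∧ IsCycleExcess K a k b c := by
    intro p q r hpq hpr hqr h
    obtain ⟨c, hc⟩ : ∃ c, c = min (K p q - K q p) (min (K q r - K r q) (K r p - K p r)) := ⟨_, rfl⟩
    by_cases h1 : q ≠ t ∧ p ≠ z
    · exact ⟨p, q, r, c, h1.1, h1.2, hpq, hpr, hqr, by omega, by omega, by omega⟩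
    by_cases h2 : r ≠ t ∧ q ≠ z
    · exact ⟨q, r, p, c, h2.1, h2.2, hqr, hpq.symm, hpr.symm, by omega, by omega, by omega⟩
    · exact ⟨r, p, q, c, by omega, by omega, hpr.symm, hqr.symm, hpq, by omega, by omega,
        by omega⟩
  by_cases h : K 1 0 ≤ K 0 1 ∨ K 2 1 ≤ K 1 2 ∨ K 0 2 ≤ K 2 0
  · exact key 0 1 2 (by decide) (by decide) (by decide) h
  · exact key 0 2 1 (by decide) (by decide) (by decide) (by omega)

/-! ### Counting the sums -/

section Counting

variable {K : Fin 3 → Fin 3 → ℕ} {a k b : Fin 3} {c n : ℕ}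

/-- What remains after the cycle is acyclic, so the total number of sums is the sum of the rates
over a transitive orientation of the triangle. -/
lemma IsCycleExcess.sum_size_le (h : IsCycleExcess K a k b c)
    (H : ∀ p q r, p ≠ q → p ≠ r → q ≠ r → K q p + K r p + K r q ≤ n) :
    ∑ e, cycleSize K a k b c e ≤ n := by
  obtain ⟨hak, hab, hkb, hc1, hc2, hc3⟩ := h
  have i1 := H a k b hak hab hkb
  have i2 := H a b k hab hak hkb.symm
  have i3 := H k a b hak.symm hkb hab
  have i4 := H k b a hkb hak.symm hab.symm
  have i5 := H b a k hab.symm hkb.symm hak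
  have i6 := H b k a hkb.symm hab.symm hak.symm
  clear H
  rw [Fin.sum_univ_three]
  simp only [cycleSize]
  generalize K a k = x1 at *
  generalize K k a = x2 at *
  generalize K k b = x3 at *
  generalize K b k = x4 at *
  generalize K b a = x5 at *
  generalize K a b = x6 at *
  rcases hc1 with rfl | ⟨hc1, hc1', hc1''⟩
  · omega
  -- For `c > 0` the cycle direction dominates on every pair; deciding the maxima by hand keeps the
  -- number of cases small.
  · rw [max_eq_left (by omega : c + x2 ≤ x1), max_eq_left (by omega : c + x4 ≤ x3),
      max_eq_left (by omega : x6 ≤ x5 - c)]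
    omega

/-- User `k` is excluded: it takes part in `c` sums more than it has bits. -/
lemma IsCycleExcess.sum_source_le (h : IsCycleExcess K a k b c)
    {p q r : Fin 3} (hp : p ≠ k) (hpq : p ≠ q) (hpr : p ≠ r)
    (hqr : q ≠ r) (H : K p q + K p r ≤ n) : ∑ e, cycleSource K a k b c e p ≤ n := by
  obtain ⟨hak, hab, hkb, hc1, -, -⟩ := h
  rw [Fin.sum_univ_three]
  simp only [cycleSource]
  rcases eq_of_three hak hab hkb p with rfl | rfl | rfl <;>
  rcases eq_of_three hak hab hkb q with rfl | rfl | rfl <;>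
  rcases eq_of_three hak hab hkb r with rfl | rfl | rfl <;>
  first
  | contradiction
  | (simp only [hab, hak, hab.symm, hkb.symm, if_true, if_false]; omega)

/-- User `a` is excluded: it needs `c` sums more than it has bits to recover. -/
lemma IsCycleExcess.sum_sink_le (h : IsCycleExcess K a k b c)
    {p q r : Fin 3} (hp : p ≠ a) (hpq : p ≠ q) (hpr : p ≠ r)
    (hqr : q ≠ r) (H : K q p + K r p ≤ n) : 
    ∑ e, (cycleSink K a k b c e p - cycleSinkStart k c e p) ≤ n := by
  obtain ⟨hak, hab, hkb, hc1, -, -⟩ := h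
  rw [Fin.sum_univ_three]
  simp only [cycleSink, cycleSinkStart, show (0 : Fin 3) ≠ 1 by decide,
    show (2 : Fin 3) ≠ 1 by decide, false_and, true_and, if_false]
  rcases eq_of_three hak hab hkb p with rfl | rfl | rfl <;>
  rcases eq_of_three hak hab hkb q with rfl | rfl | rfl <;>
  rcases eq_of_three hak hab hkb r with rfl | rfl | rfl <;>
  first
  | contradiction
  | (simp only [hak.symm, hkb, hab.symm, hkb.symm, if_true, if_false]; omega)

/-- Bound on the sums in which at least one of the users `p` and `q` takes part. -/
lemma IsCycleExcess.sum_max_source_le (h : IsCycleExcess K a k b c)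
    {p q r : Fin 3} (hpq : p ≠ q) (hpr : p ≠ r)
    (hqr : q ≠ r) (H : K p r + K q r + K p q ≤ n) (H' : K p r + K q r + K q p ≤ n) :
    ∑ e, max (cycleSource K a k b c e p) (cycleSource K a k b c e q) ≤ n := by
  obtain ⟨hak, hab, hkb, hc1, -, -⟩ := h
  rw [Fin.sum_univ_three]
  simp only [cycleSource]
  rcases eq_of_three hak hab hkb p with rfl | rfl | rfl <;>
  rcases eq_of_three hak hab hkb q with rfl | rfl | rfl <;>
  rcases eq_of_three hak hab hkb r with rfl | rfl | rfl <;>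
  first
  | contradiction
  | (simp only [hak, hab, hkb, hak.symm, hab.symm, hkb.symm, if_true, if_false]; omega)

/-- Bound on the sums that at least one of the users `p` and `q` needs. -/
lemma IsCycleExcess.sum_max_sink_le (h : IsCycleExcess K a k b c)
    {p q r : Fin 3} (hpq : p ≠ q) (hpr : p ≠ r)
    (hqr : q ≠ r) (H : K r p + K r q + K p q ≤ n) (H' : K r p + K r q + K q p ≤ n) :
    ∑ e, max (cycleSink K a k b c e p) (cycleSink K a k b c e q) ≤ n := by
  obtain ⟨hak, hab, hkb, hc1, -, -⟩ := h
  rw [Fin.sum_univ_three]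
  simp only [cycleSink]
  rcases eq_of_three hak hab hkb p with rfl | rfl | rfl <;>
  rcases eq_of_three hak hab hkb q with rfl | rfl | rfl <;>
  rcases eq_of_three hak hab hkb r with rfl | rfl | rfl <;>
  first
  | contradiction
  | (simp only [hak, hab, hkb, hak.symm, hab.symm, hkb.symm, if_true, if_false]; omega)

end Counting

/-- Integral tuples that satisfy the inequalities of the capacity region have a scheme. -/
lemma exists_relayScheme (K : Fin 3 → Fin 3 → ℕ) (nU nD : Fin 3 → ℕ) {u v t w y z : Fin 3}
    (huv : u ≠ v) (hut : u ≠ t) (hvt : v ≠ t) (hwy : w ≠ y) (hwz : w ≠ z) (hyz : y ≠ z)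
    (hUp₁ : nU v ≤ nU u) (hUp₂ : nU t ≤ nU v) (hDown₁ : nD y ≤ nD w) (hDown₂ : nD z ≤ nD y)
    (ht : K t u + K t v ≤ nU t) (hz : K w z + K y z ≤ nD z)
    (hv : K t u + K v u + max (K t v) (K v t) ≤ nU v)
    (hy : K w z + K w y + max (K y z) (K z y) ≤ nD y)
    (hU : ∀ p q r, p ≠ q → p ≠ r → q ≠ r → K q p + K r p + K r q ≤ nU u)
    (hD : ∀ p q r, p ≠ q → p ≠ r → q ≠ r → K q p + K r p + K r q ≤ nD w) :
    Nonempty (RelayScheme K nU nD) := by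
  obtain ⟨a, k, b, c, hkt, haz, hc⟩ := exists_cycle K t z
  obtain ⟨f, hf, hflt, hfcap⟩ := exists_slots (cycleSize K a k b c) (fun _ _ => 0)
    (cycleSource K a k b c) nU huv hut hvt hUp₁ hUp₂
    (hc.sum_source_le hkt.symm hut.symm hvt.symm huv ht)
    (hc.sum_max_source_le hvt.symm hut.symm huv.symm (by omega) (by omega)) (hc.sum_size_le hU)
  obtain ⟨g, hg, -, hgcap⟩ := exists_slots (cycleSize K a k b c) (cycleSinkStart k c)
    (cycleSink K a k b c) nD hwy hwz hyz hDown₁ hDown₂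
    (hc.sum_sink_le haz.symm hwz.symm hyz.symm hwy hz)
    (hc.sum_max_sink_le hyz.symm hwz.symm hwy.symm (by omega) (by omega)) (hc.sum_size_le hD)
  exact ⟨{
    J := Σ e : Fin 3, Fin (cycleSize K a k b c e)
    contrib := fun i j => cycleContrib a k b c j.1 j.2 i
    up := f
    down := g
    up_injective := hf
    down_injective := hg
    up_lt := hflt
    contrib_eq_zero := fun i j y hy hj => cycleContrib_eq_zero j.1 hy
      (not_lt.1 fun hlt => absurd (hfcap j i (Nat.zero_le _) hlt) (not_lt.2 hj))
    decodes := fun i x x' hx hx' hi h l hl => cycle_decodes hc.ne_ak hc.ne_ab hc.ne_kb i hx hx' hi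
      (fun e m hm₀ hm hm' => h ⟨e, ⟨m, hm'⟩⟩ (hgcap ⟨e, ⟨m, hm'⟩⟩ i hm₀ hm)) l hl }⟩

/-! ### Pipelined codes -/

section Received

variable {q : ℕ} {M : UserPair → ℕ} (c : Code q M) (nUp nDown : Fin 3 → ℕ) (W : Messages M)

lemma Code.length_received_relay (n : ℕ) : (c.received nUp nDown W n).1.length = n := by
  induction n with
  | zero => rfl
  | succ n ih => exact congrArg (· + 1) ih

lemma Code.length_received_user (n : ℕ) (i : Fin 3) :
    ((c.received nUp nDown W n).2 i).length = n := by
  induction n with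
  | zero => rfl
  | succ n ih => exact congrArg (· + 1) ih

lemma Code.received_relay_getElem? {n s : ℕ} (hs : s < n) :
    (c.received nUp nDown W n).1[n - 1 - s]? = some (uplink nUp (c.userInput nUp nDown W s)) := by
  induction n with
  | zero => omega
  | succ n ih =>
    rcases Nat.lt_succ_iff_lt_or_eq.1 hs with hs | rfl
    · have : n + 1 - 1 - s = (n - 1 - s) + 1 := by omega
      rw [this, ← ih hs]
      rfl
    · have : s + 1 - 1 - s = 0 := by omega
      rw [this]
      rfl

lemma Code.received_user_getElem? {n s : ℕ} (hs : s < n) (i : Fin 3) :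
    ((c.received nUp nDown W n).2 i)[n - 1 - s]? =
      some (downlink nDown i (c.relayInput nUp nDown W s)) := by
  induction n with
  | zero => omega
  | succ n ih =>
    rcases Nat.lt_succ_iff_lt_or_eq.1 hs with hs | rfl
    · have : n + 1 - 1 - s = (n - 1 - s) + 1 := by omega
      rw [this, ← ih hs]
      rfl
    · have : s + 1 - 1 - s = 0 := by omega
      rw [this]
      rfl

end Received

/-- The decoders can be chosen last: it suffices that each message is determined by what is known
at its destination. -/
lemma Code.exists_correct {q : ℕ} {M : UserPair → ℕ} (hM : ∀ p, 0 < M p) {nUp nDown : Fin 3 → ℕ}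
    (c : Code q M) (N : ℕ)
    (h : ∀ (p : UserPair) (W W' : Messages M), own W p.1.2 = own W' p.1.2 →
      (c.received nUp nDown W N).2 p.1.2 = (c.received nUp nDown W' N).2 p.1.2 → W p = W' p) :
    ∃ c' : Code q M, ∀ W, c'.Correct nUp nDown N W := by
  classical
  let c' : Code q M :=
    { c with
      decode := fun p o l =>
        if hW : ∃ W : Messages M, own W p.1.2 = o ∧ (c.received nUp nDown W N).2 p.1.2 = l then
          hW.choose p else ⟨0, hM p⟩ }
  have hrec : ∀ W n, c'.received nUp nDown W n = c.received nUp nDown W n := by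
    intro W n
    induction n with
    | zero => rfl
    | succ n ih =>
      simp only [Code.received, ih]
      rfl
  refine ⟨c', fun W p => ?_⟩
  rw [hrec]
  have hW : ∃ W' : Messages M, own W' p.1.2 = own W p.1.2 ∧
      (c.received nUp nDown W' N).2 p.1.2 = (c.received nUp nDown W N).2 p.1.2 := ⟨W, rfl, rfl⟩
  change (if hW : _ then _ else _) = _
  rw [dif_pos hW]
  exact h p _ _ hW.choose_spec.1 hW.choose_spec.2

section Pipeline

variable {K : Fin 3 → Fin 3 → ℕ} {nUp nDown : Fin 3 → ℕ} {L q : ℕ} {M : UserPair → ℕ}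

/-- The bit strings that user `i` sends in block `k` when its messages are `o`, where the message
`m` of the pair `p` is represented in block `k` by the bits `ψ p m k`. -/
def ownBits (ψ : ∀ p : UserPair, Fin (M p) → ℕ → ℕ → ZMod 2) (i : Fin 3) (o : OwnMessages M i)
    (k : ℕ) : Fin 3 → ℕ → ZMod 2 := fun j =>
  if h : i ≠ j then ψ ⟨(i, j), h⟩ (o ⟨⟨(i, j), h⟩, rfl⟩) k else 0

/-- All the bit strings of block `k`. -/
def blockBits (ψ : ∀ p : UserPair, Fin (M p) → ℕ → ℕ → ZMod 2) (W : Messages M) (k : ℕ) :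
    Fin 3 → Fin 3 → ℕ → ZMod 2 := fun i => ownBits ψ i (own W i) k

/-- The bit at height `h` above the lowest level of a signal; zero if there is no such level. -/
def bitAbove (x : Signal q) (h : ℕ) : ZMod 2 :=
  if hq : h < q then x ⟨q - 1 - h, by omega⟩ else 0

/-- The code that applies a one-block scheme to consecutive blocks of `L` channel uses. The slot
`e` is the channel use `e % L` of the block, at height `e / L` above the lowest level of the relay
in the uplink, and at depth `e / L` below the highest level in the downlink. During each block the
relay forwards what it received in the block before. The decoders are dummies. -/
noncomputable def pipelinedCode (hM : ∀ p, 0 < M p)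
    (S : RelayScheme K (fun i => L * nUp i) (fun i => L * nDown i))
    (ψ : ∀ p : UserPair, Fin (M p) → ℕ → ℕ → ZMod 2) : Code q M where
  encode i o l := fun lev => ∑ j, if S.up j = (nUp i - 1 - lev) * L + l.length % L then
    S.contrib i j (ownBits ψ i o (l.length / L)) else 0
  relay l := fun lev => ∑ j, if S.down j = lev * L + (l.length - 1) % L then
    bitAbove ((l[l.length - 1 - (((l.length - 1) / L - 1) * L + S.up j % L)]?).getD 0)
      (S.up j / L) else 0
  decode p _ _ := ⟨0, hM p⟩

variable (hM : ∀ p, 0 < M p) (S : RelayScheme K (fun i => L * nUp i) (fun i => L * nDown i))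
  {ψ : ∀ p : UserPair, Fin (M p) → ℕ → ℕ → ZMod 2}

lemma blockBits_eq_zero (hψ : ∀ p m k n, K p.1.1 p.1.2 ≤ n → ψ p m k n = 0) (W : Messages M)
    (k : ℕ) (i j : Fin 3) (n : ℕ) (hn : K i j ≤ n) : blockBits ψ W k i j n = 0 := by
  unfold blockBits ownBits
  split_ifs with h
  · exact hψ ⟨(i, j), h⟩ _ _ _ hn
  · rfl

/-- In its slot of block `k` the relay receives the sum number `j` of that block. -/
lemma pipelinedCode_uplink (hL : 0 < L) (hq : ∀ i, nUp i ≤ q)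
    (hψ : ∀ p m k n, K p.1.1 p.1.2 ≤ n → ψ p m k n = 0) (W : Messages M) (k : ℕ) (j : S.J) :
    bitAbove (uplink nUp ((pipelinedCode (q := q) hM S ψ).userInput nUp nDown W
      (k * L + S.up j % L))) (S.up j / L) = ∑ i, S.contrib i j (blockBits ψ W k i) := by
  have hlt : S.up j / L < q := by
    obtain ⟨i, hi⟩ := S.up_lt j
    exact (Nat.div_lt_of_lt_mul hi).trans_le (hq i)
  have hmod : S.up j % L < L := Nat.mod_lt _ hL
  have hdiv : (k * L + S.up j % L) / L = k := by
    rw [mul_comm, Nat.mul_add_div hL, Nat.div_eq_of_lt hmod, add_zero]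
  have hmod' : (k * L + S.up j % L) % L = S.up j % L := by
    rw [mul_comm, Nat.mul_add_mod, Nat.mod_mod]
  rw [bitAbove, dif_pos hlt, uplink, Finset.sum_apply]
  refine Finset.sum_congr rfl fun i _ => ?_
  have hqi := hq i
  by_cases hi : S.up j / L < nUp i
  · have h1 : q - nUp i ≤ q - 1 - S.up j / L := by omega
    have h2 : nUp i - 1 - (q - 1 - S.up j / L - (q - nUp i)) = S.up j / L := by
      generalize S.up j / L = d at hi ⊢
      omega
    simp only [shift, h1, if_true, Code.userInput, pipelinedCode, Code.length_received_user, h2,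
      hdiv, hmod', Nat.div_add_mod']
    rw [Finset.sum_eq_single j]
    · simp [blockBits]
    · intro j' _ hj'
      rw [if_neg fun e => hj' (S.up_injective e)]
    · simp
  · have h1 : ¬ q - nUp i ≤ q - 1 - S.up j / L := by omega
    simp only [shift, h1, if_false]
    refine (S.contrib_eq_zero i j _ (fun l n hn => blockBits_eq_zero hψ W k i l n hn) ?_).symm
    rw [not_lt, Nat.le_div_iff_mul_le hL] at hi
    simpa [mul_comm] using hi

/-- During block `k + 1` the relay transmits the sum number `j` of block `k` in its slot. -/
lemma pipelinedCode_relayInput (hL : 0 < L) (hq : ∀ i, nUp i ≤ q)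
    (hψ : ∀ p m k n, K p.1.1 p.1.2 ≤ n → ψ p m k n = 0) (W : Messages M) (k : ℕ) (j : S.J)
    (hj : S.down j / L < q) :
    (pipelinedCode (q := q) hM S ψ).relayInput nUp nDown W ((k + 1) * L + S.down j % L)
      ⟨S.down j / L, hj⟩ = ∑ i, S.contrib i j (blockBits ψ W k i) := by
  have hmod : S.down j % L < L := Nat.mod_lt _ hL
  have hdiv : ((k + 1) * L + S.down j % L) / L = k + 1 := by
    rw [mul_comm, Nat.mul_add_div hL, Nat.div_eq_of_lt hmod, add_zero]
  have hmod' : ((k + 1) * L + S.down j % L) % L = S.down j % L := by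
    rw [mul_comm, Nat.mul_add_mod, Nat.mod_mod]
  rw [← pipelinedCode_uplink hM S hL hq hψ W k j]
  have hs : k * L + S.up j % L < (k + 1) * L + S.down j % L + 1 := by
    have := Nat.mod_lt (S.up j) hL
    rw [add_mul]
    omega
  unfold Code.relayInput
  rw [pipelinedCode]
  simp only [← pipelinedCode.eq_1]
  simp only [Code.length_received_relay, Nat.add_sub_cancel, hdiv, hmod', Nat.div_add_mod']
  rw [Finset.sum_eq_single j]
  · have := (pipelinedCode (q := q) hM S ψ).received_relay_getElem? nUp nDown W hs
    rw [Nat.add_sub_cancel] at this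
    rw [if_pos rfl, this, Option.getD_some]
  · intro j' _ hj'
    rw [if_neg fun e => hj' (S.down_injective e)]
  · simp

/-- A scheme for one block yields codes without errors for `N / L - 1` blocks of messages; the last
block is needed for forwarding. -/
lemma RelayScheme.exists_code (hM : ∀ p, 0 < M p)
    (S : RelayScheme K (fun i => L * nUp i) (fun i => L * nDown i)) (hL : 0 < L)
    (hqU : ∀ i, nUp i ≤ q) (hqD : ∀ i, nDown i ≤ q)
    (N : ℕ) (hψ : ∀ p m k n, K p.1.1 p.1.2 ≤ n → ψ p m k n = 0)
    (hinj : ∀ p m m', (∀ k < N / L - 1, ψ p m k = ψ p m' k) → m = m') :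
    ∃ c : Code q M, ∀ W, c.Correct nUp nDown N W := by
  refine (pipelinedCode (q := q) hM S ψ).exists_correct hM N ?_
  rintro ⟨⟨l, i⟩, hli⟩ W W' hown hrec
  simp only at hown hrec
  refine hinj _ _ _ fun k hk => ?_
  have hbits := S.decodes i (blockBits ψ W k) (blockBits ψ W' k) (blockBits_eq_zero hψ W k)
    (blockBits_eq_zero hψ W' k) (by simp only [blockBits, hown]) (fun j hj => ?_) l hli
  · simpa only [blockBits, ownBits, dif_pos hli, own] using hbits
  · have hlev : S.down j / L < nDown i := Nat.div_lt_of_lt_mul hj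
    have hqi := hqD i
    have hlq : S.down j / L < q := hlev.trans_le hqi
    rw [← pipelinedCode_relayInput hM S hL hqU hψ W k j hlq,
      ← pipelinedCode_relayInput hM S hL hqU hψ W' k j hlq]
    have hs : (k + 1) * L + S.down j % L < N := by
      have h1 := Nat.mod_lt (S.down j) hL
      have h2 : (k + 2) * L ≤ N := (Nat.le_div_iff_mul_le hL).1 (by omega)
      have h3 : (k + 2) * L = (k + 1) * L + L := by ring
      omega
    have h := (pipelinedCode (q := q) hM S ψ).received_user_getElem? nUp nDown W hs i
    rw [hrec, Code.received_user_getElem? _ _ _ _ hs, Option.some_inj] at h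
    have h' := congrFun h.symm ⟨S.down j / L + (q - nDown i), by omega⟩
    simpa [downlink, shift] using h'

end Pipeline

/-! ### Achievability -/

lemma messageCount_pos (R : RateTuple) (N : ℕ) (p : UserPair) : 0 < messageCount R N p :=
  Nat.ceil_pos.2 (Real.rpow_pos_of_pos two_pos _)

/-- Represent each message by `B` blocks of `K` bits. -/
lemma exists_blockRepresentation {M : UserPair → ℕ} {K : Fin 3 → Fin 3 → ℕ} {B : ℕ}
    (h : ∀ p, M p ≤ 2 ^ (K p.1.1 p.1.2 * B)) :
    ∃ ψ : ∀ p : UserPair, Fin (M p) → ℕ → ℕ → ZMod 2,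
      (∀ p m k n, K p.1.1 p.1.2 ≤ n → ψ p m k n = 0) ∧
      ∀ p m m', (∀ k < B, ψ p m k = ψ p m' k) → m = m' := by
  have he : ∀ p, Nonempty (Fin (M p) ↪ (Fin B → Fin (K p.1.1 p.1.2) → ZMod 2)) := fun p =>
    Function.Embedding.nonempty_of_card_le (by simpa [ZMod.card, ← pow_mul] using h p)
  let e := fun p => (he p).some
  refine ⟨fun p m k n => if hkn : k < B ∧ n < K p.1.1 p.1.2 then
    e p m ⟨k, hkn.1⟩ ⟨n, hkn.2⟩ else 0, fun p m k n hn => ?_, fun p m m' hm => ?_⟩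
  · exact dif_neg fun hkn => absurd hkn.2 (not_lt.2 hn)
  · refine (e p).injective (funext fun k => funext fun n => ?_)
    simpa using congrFun (hm k k.2) n

lemma Code.errorProb_eq_zero {q : ℕ} {M : UserPair → ℕ} {c : Code q M} {nUp nDown : Fin 3 → ℕ}
    {N : ℕ} (h : ∀ W, c.Correct nUp nDown N W) : c.errorProb nUp nDown N = 0 := by
  simp [Code.errorProb, h]

lemma nUp_le_numLevels (nUp nDown : Fin 3 → ℕ) (i : Fin 3) : nUp i ≤ numLevels nUp nDown :=
  (Finset.le_sup (Finset.mem_univ i)).trans (le_max_left _ _)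

lemma nDown_le_numLevels (nUp nDown : Fin 3 → ℕ) (i : Fin 3) : nDown i ≤ numLevels nUp nDown :=
  (Finset.le_sup (Finset.mem_univ i)).trans (le_max_right _ _)

/-- If the rounded tuples `⌊L * R⌋` have schemes for blocks of `L` channel uses, then every proper
fraction of `R` is achievable: it leaves room for the rounding and for the forwarding delay. -/
lemma achievable_smul {nUp nDown : Fin 3 → ℕ} {R : RateTuple} (hR : ∀ p, 0 ≤ R p)
    (hS : ∀ L : ℕ, Nonempty (RelayScheme (fun i j => ⌊(L : ℝ) * R.rate i j⌋₊)
      (fun i => L * nUp i) (fun i => L * nDown i)))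
    {ε : ℝ} (hε : 0 < ε) (hε1 : ε ≤ 1) : Achievable nUp nDown ((1 - ε) • R) := by
  refine ⟨fun p => mul_nonneg (by linarith) (hR p), ?_⟩
  have hL : ∀ᶠ L : ℕ in Filter.atTop, 0 < L ∧ ∀ p, 0 < R p → 1 / (ε * R p) < (L : ℝ) := by
    refine (Filter.eventually_gt_atTop 0).and (Filter.eventually_all.2 fun p => ?_)
    exact (tendsto_natCast_atTop_atTop.eventually_gt_atTop _).mono fun _ h _ => h
  obtain ⟨L, hL0, hL⟩ := hL.exists
  obtain ⟨S⟩ := hS L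
  have hLpos : (0 : ℝ) < L := by exact_mod_cast hL0
  have hrate : ∀ p : UserPair, R.rate p.1.1 p.1.2 = R p := fun p => R.rate_of_ne p.2
  have hN : ∀ᶠ N : ℕ in Filter.atTop, ∀ p : UserPair,
      (N : ℝ) * ((1 - ε) • R) p ≤ (⌊(L : ℝ) * R.rate p.1.1 p.1.2⌋₊ * (N / L - 1) : ℕ) := by
    refine Filter.eventually_all.2 fun p => ?_
    rw [hrate, Pi.smul_apply, smul_eq_mul]
    rcases (hR p).eq_or_lt with h0 | hpos
    · simp [← h0]
    set K : ℕ := ⌊(L : ℝ) * R p⌋₊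
    -- The rounded rate per channel use exceeds the target rate.
    have hK : (L : ℝ) * ((1 - ε) * R p) < K := by
      have h1 := Nat.lt_floor_add_one ((L : ℝ) * R p)
      have h2 := hL p hpos
      rw [div_lt_iff₀ (mul_pos hε hpos)] at h2
      change _ < (K : ℝ) + 1 at h1
      nlinarith
    have hd : 0 < (K : ℝ) - L * ((1 - ε) * R p) := by linarith
    filter_upwards [tendsto_natCast_atTop_atTop.eventually_ge_atTop
      (2 * K * L / ((K : ℝ) - L * ((1 - ε) * R p)))] with N hN
    rw [div_le_iff₀ hd] at hN
    -- There are at least `N / L - 2` blocks, where the division is exact.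
    have hB : (N : ℝ) ≤ L * ((N / L - 1 : ℕ) + 2) := by
      have h1 := Nat.div_add_mod N L
      have h2 := Nat.mod_lt N hL0
      have h3 : N ≤ L * (N / L - 1 + 2) := by
        calc N ≤ L * (N / L + 1) := by rw [mul_add]; omega
          _ ≤ _ := Nat.mul_le_mul_left _ (by omega)
      exact_mod_cast h3
    push_cast
    have hB' := mul_le_mul_of_nonneg_left hB (Nat.cast_nonneg (α := ℝ) K)
    refine le_of_mul_le_mul_left ?_ hLpos
    nlinarith
  have hcode : ∀ N : ℕ, ∃ c : Code (numLevels nUp nDown) (messageCount ((1 - ε) • R) N),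
      (∀ p : UserPair, (N : ℝ) * ((1 - ε) • R) p ≤
        (⌊(L : ℝ) * R.rate p.1.1 p.1.2⌋₊ * (N / L - 1) : ℕ)) →
      ∀ W, c.Correct nUp nDown N W := by
    intro N
    by_cases h : ∀ p : UserPair, (N : ℝ) * ((1 - ε) • R) p ≤
        (⌊(L : ℝ) * R.rate p.1.1 p.1.2⌋₊ * (N / L - 1) : ℕ)
    · obtain ⟨ψ, hψ, hinj⟩ := exists_blockRepresentation
        (K := fun i j => ⌊(L : ℝ) * R.rate i j⌋₊) (B := N / L - 1)
        (M := messageCount ((1 - ε) • R) N) fun p => by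
          refine Nat.ceil_le.2 ?_
          rw [Nat.cast_pow, Nat.cast_ofNat, ← Real.rpow_natCast]
          exact Real.rpow_le_rpow_of_exponent_le one_le_two (h p)
      obtain ⟨c, hc⟩ := RelayScheme.exists_code (messageCount_pos _ N) S hL0
        (nUp_le_numLevels nUp nDown) (nDown_le_numLevels nUp nDown) N hψ hinj
      exact ⟨c, fun _ => hc⟩
    · exact ⟨⟨fun _ _ _ => 0, fun _ => 0, fun p _ _ => ⟨0, messageCount_pos _ N p⟩⟩,
        fun h' => absurd h' h⟩
  choose c hc using hcode
  exact ⟨c, tendsto_const_nhds.congr' (hN.mono fun N h =>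
    (Code.errorProb_eq_zero (hc N h)).symm)⟩

/-- The four inequalities with a maximum say that the sum over each transitive orientation of the
triangle is at most `n`. -/
lemma chain_le {f : Fin 3 → Fin 3 → ℝ} {n : ℝ} {u v t : Fin 3}
    (huv : u ≠ v) (hut : u ≠ t) (hvt : v ≠ t)
    (h1 : f t u + f v u + max (f t v) (f v t) ≤ n)
    (h2 : f u v + f u t + max (f t v) (f v t) ≤ n)
    (h3 : f v u + f v t + max (f t u) (f u t) ≤ n)
    (h4 : f t u + f t v + max (f u v) (f v u) ≤ n)
    (p q r : Fin 3) (hpq : p ≠ q) (hpr : p ≠ r) (hqr : q ≠ r) :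
    f q p + f r p + f r q ≤ n := by
  have i1 := le_max_left (f t v) (f v t)
  have i2 := le_max_right (f t v) (f v t)
  have i3 := le_max_left (f t u) (f u t)
  have i4 := le_max_right (f t u) (f u t)
  have i5 := le_max_left (f u v) (f v u)
  have i6 := le_max_right (f u v) (f v u)
  rcases eq_of_three huv hut hvt p with rfl | rfl | rfl <;>
  rcases eq_of_three huv hut hvt q with rfl | rfl | rfl <;>
  rcases eq_of_three huv hut hvt r with rfl | rfl | rfl <;>
  first
  | contradiction
  | linarith

lemma floor_add_le {L n : ℕ} {x y : ℝ} (hx : 0 ≤ x) (hy : 0 ≤ y) (h : x + y ≤ n) :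
    ⌊(L : ℝ) * x⌋₊ + ⌊(L : ℝ) * y⌋₊ ≤ L * n := by
  have h1 := Nat.floor_le (mul_nonneg (Nat.cast_nonneg L) hx)
  have h2 := Nat.floor_le (mul_nonneg (Nat.cast_nonneg L) hy)
  have h3 := mul_le_mul_of_nonneg_left h (Nat.cast_nonneg (α := ℝ) L)
  have : ((⌊(L : ℝ) * x⌋₊ : ℝ) + ⌊(L : ℝ) * y⌋₊) ≤ L * n := by linarith
  exact_mod_cast this

lemma floor_add_add_le {L n : ℕ} {x y z : ℝ} (hx : 0 ≤ x) (hy : 0 ≤ y) (hz : 0 ≤ z)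
    (h : x + y + z ≤ n) :
    ⌊(L : ℝ) * x⌋₊ + ⌊(L : ℝ) * y⌋₊ + ⌊(L : ℝ) * z⌋₊ ≤ L * n := by
  have h1 := Nat.floor_le (mul_nonneg (Nat.cast_nonneg L) hx)
  have h2 := Nat.floor_le (mul_nonneg (Nat.cast_nonneg L) hy)
  have h3 := Nat.floor_le (mul_nonneg (Nat.cast_nonneg L) hz)
  have h4 := mul_le_mul_of_nonneg_left h (Nat.cast_nonneg (α := ℝ) L)
  have : ((⌊(L : ℝ) * x⌋₊ : ℝ) + ⌊(L : ℝ) * y⌋₊ + ⌊(L : ℝ) * z⌋₊) ≤ L * n := by linarith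
  exact_mod_cast this

lemma RateTuple.rate_nonneg {R : RateTuple} (hR : ∀ p, 0 ≤ R p) (i j : Fin 3) :
    0 ≤ R.rate i j := by
  unfold RateTuple.rate
  split_ifs
  · exact hR _
  · exact le_rfl

@[fun_prop]
lemma RateTuple.continuous_rate (i j : Fin 3) : Continuous fun R : RateTuple => R.rate i j := by
  unfold RateTuple.rate
  split_ifs
  · exact continuous_apply _
  · exact continuous_const

end YChannel

theorem theorem2 (nUp nDown : Fin 3 → ℕ) (u v t w y z : Fin 3)
    (huv : u ≠ v) (hut : u ≠ t) (hvt : v ≠ t)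
    (hwy : w ≠ y) (hwz : w ≠ z) (hyz : y ≠ z)
    (hUp₁ : nUp v ≤ nUp u) (hUp₂ : nUp t ≤ nUp v)
    (hDown₁ : nDown y ≤ nDown w) (hDown₂ : nDown z ≤ nDown y) :
    YChannel.capacityRegion nUp nDown =
      {R : YChannel.RateTuple |
        (∀ p, 0 ≤ R p) ∧
        R.rate t u + R.rate t v ≤ nUp t ∧
        R.rate w z + R.rate y z ≤ nDown z ∧
        R.rate t u + R.rate v u + max (R.rate t v) (R.rate v t) ≤ nUp v ∧
        R.rate w z + R.rate w y + max (R.rate y z) (R.rate z y) ≤ nDown y ∧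
        R.rate u v + R.rate u t + max (R.rate t v) (R.rate v t) ≤ nUp u ∧
        R.rate v u + R.rate v t + max (R.rate t u) (R.rate u t) ≤ nUp u ∧
        R.rate t u + R.rate t v + max (R.rate u v) (R.rate v u) ≤ nUp u ∧
        R.rate w z + R.rate y z + max (R.rate w y) (R.rate y w) ≤ nDown w ∧
        R.rate y w + R.rate z w + max (R.rate z y) (R.rate y z) ≤ nDown w ∧
        R.rate w y + R.rate z y + max (R.rate w z) (R.rate z w) ≤ nDown w} := by
  open YChannel in
  apply Set.Subset.antisymm
  · refine closure_minimal (fun R hR => ?_) ?_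
    · have hUtop : ∀ i, nUp i ≤ nUp u := fun i => by
        rcases eq_of_three huv hut hvt i with rfl | rfl | rfl <;> omega
      have hDtop : ∀ i, nDown i ≤ nDown w := fun i => by
        rcases eq_of_three hwy hwz hyz i with rfl | rfl | rfl <;> omega
      have hUall := fun (a b c : Fin 3) (hab : a ≠ b) (hac : a ≠ c) (hbc : b ≠ c) =>
        hR.chain_uplink hab hac hbc (hUtop b) (hUtop c)
      have hDall := fun (a b c : Fin 3) (hab : a ≠ b) (hac : a ≠ c) (hbc : b ≠ c) =>
        hR.chain_downlink hab hac hbc (hDtop a) (hDtop b)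
      have hv₁ := hR.chain_uplink huv hut hvt le_rfl hUp₂
      have hv₂ := hR.chain_uplink hut huv hvt.symm hUp₂ le_rfl
      have hy₁ := hR.chain_downlink hyz hwy.symm hwz.symm le_rfl hDown₂
      have hy₂ := hR.chain_downlink hyz.symm hwz.symm hwy.symm hDown₂ le_rfl
      have hUvu : (nUp v : ℝ) ≤ nUp u := by exact_mod_cast hUp₁
      have hDyw : (nDown y : ℝ) ≤ nDown w := by exact_mod_cast hDown₁
      have u1 := hUall v t u hvt huv.symm hut.symm
      have u2 := hUall v u t huv.symm hvt hut
      have u3 := hUall t v u hvt.symm hut.symm huv.symm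
      have u4 := hUall t u v hut.symm hvt.symm huv
      have d1 := hDall z w y hwz.symm hyz.symm hwy
      have d2 := hDall w y z hwy hwz hyz
      have d3 := hDall w z y hwz hwy hyz.symm
      have d4 := hDall y w z hwy.symm hyz hwz
      refine ⟨hR.1, hR.cut_uplink hut.symm hvt.symm huv,
        hR.cut_downlink hwz.symm hyz.symm hwy, ?_, ?_, ?_, ?_, ?_, ?_, ?_, ?_⟩ <;>
      rw [← le_sub_iff_add_le', max_le_iff] <;> constructor <;> linarith
    · simp only [Set.ofPred_and, Set.ofPred_forall]
      refine IsClosed.inter (isClosed_iInter fun p => isClosed_le continuous_const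
        (continuous_apply p)) ?_
      repeat' refine IsClosed.inter ?_ ?_
      all_goals exact isClosed_le (by fun_prop) continuous_const
  · rintro R ⟨hR, ht, hz, hv, hy, h5, h6, h7, h8, h9, h10⟩
    have hUvu : (nUp v : ℝ) ≤ nUp u := by exact_mod_cast hUp₁
    have hDyw : (nDown y : ℝ) ≤ nDown w := by exact_mod_cast hDown₁
    have h0 := RateTuple.rate_nonneg hR
    have hUall := chain_le (f := R.rate) huv hut hvt (hv.trans hUvu) h5 h6 h7
    -- The downlink inequalities are the uplink inequalities for the reversed messages.
    have hDall := chain_le (f := fun i j => R.rate j i) (n := nDown w) hwy hwz hyz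
      (hy.trans hDyw) (by rwa [max_comm]) h10 (by rwa [max_comm])
    have hS : ∀ L : ℕ, Nonempty (RelayScheme (fun i j => ⌊(L : ℝ) * R.rate i j⌋₊)
        (fun i => L * nUp i) (fun i => L * nDown i)) := by
      intro L
      refine exists_relayScheme _ _ _ huv hut hvt hwy hwz hyz (Nat.mul_le_mul_left L hUp₁)
        (Nat.mul_le_mul_left L hUp₂) (Nat.mul_le_mul_left L hDown₁)
        (Nat.mul_le_mul_left L hDown₂) (floor_add_le (h0 _ _) (h0 _ _) ht)
        (floor_add_le (h0 _ _) (h0 _ _) hz) ?_ ?_ ?_ ?_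
      · have a1 := floor_add_add_le (L := L) (h0 t u) (h0 v u) (h0 t v)
          ((add_le_add_right (le_max_left _ _) _).trans hv)
        have a2 := floor_add_add_le (L := L) (h0 t u) (h0 v u) (h0 v t)
          ((add_le_add_right (le_max_right _ _) _).trans hv)
        omega
      · have a1 := floor_add_add_le (L := L) (h0 w z) (h0 w y) (h0 y z)
          ((add_le_add_right (le_max_left _ _) _).trans hy)
        have a2 := floor_add_add_le (L := L) (h0 w z) (h0 w y) (h0 z y)
          ((add_le_add_right (le_max_right _ _) _).trans hy)
        omega
      · exact fun p q r hpq hpr hqr => floor_add_add_le (h0 _ _) (h0 _ _) (h0 _ _)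
          (hUall p q r hpq hpr hqr)
      · exact fun p q r hpq hpr hqr => floor_add_add_le (h0 _ _) (h0 _ _) (h0 _ _)
          (by have := hDall r q p hqr.symm hpr.symm hpq.symm; linarith)
    have hlim : Filter.Tendsto (fun n : ℕ => (1 - 1 / ((n : ℝ) + 1)) • R) Filter.atTop
        (nhds R) := by
      have := ((tendsto_const_nhds (x := (1 : ℝ))).sub
        (tendsto_one_div_add_atTop_nhds_zero_nat (𝕜 := ℝ))).smul_const R
      simpa using this
    refine mem_closure_of_tendsto hlim (Filter.Eventually.of_forall fun n => ?_)
    refine achievable_smul hR hS (by positivity) ?_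
    rw [div_le_one (by positivity)]
    linarith [Nat.cast_nonneg (α := ℝ) n]
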